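/- Let $d\ge 2$ and let $\Omega\subset\mathbb{R}^d$ be a bounded open set with boundary of class $\mathcal{C}^1$ (locally, $\Omega$ is the set where a $\mathcal{C}^1$ function with non-vanishing gradient is negative). Let $n(x)$ be the outward unit normal at $x\in\partial\Omega$, let $\pi$ be the Lebesgue surface measure on $\partial\Omega$ (the $(d-1)$-dimensional Hausdorff measure), and for $x\in\partial\Omega$, $\sigma\in\mathbb{S}^{d-1}$ let $\tau_-(x,\sigma)=\inf\{s>0 : x-s\sigma\notin\Omega\}$. For $x,y\in\partial\Omega$ put $$\mathcal{J}(x,y)=\frac{|(x-y)\cdot n(x)|}{|x-y|^{d+1}}\,|(x-y)\cdot n(y)|$$ if $(x-y)\cdot n(x)>0$, $(x-y)\cdot n(y)<0$ and $y=x-\tau_-(x,\sigma)\sigma$ with $\sigma=\frac{x-y}{|x-y|}$ (that is, the open segment from $x$ to $y$ lies in $\Omega$), and $\mathcal{J}(x,y)=0$ otherwise. Then $$\lim_{\delta\to0^+}\ \sup_{y\in\partial\Omega}\int_{\{x\in\partial\Omega\,:\,|x-y|\le\delta\}}\mathcal{J}(x,y)\,\pi(\mathrm{d}x)=0.$$ 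-/

import Mathlib

open MeasureTheory Filter Topology
open scoped ENNReal

noncomputable section

namespace DiffuseBoundary

/-- `ρ` is a local `C¹` defining function of `Ω` at the point `a`: in an open neighbourhood `U` of
`a` the function `ρ` is continuously differentiable, `Ω` is the set where `ρ` is negative, and the
gradient of `ρ` does not vanish at `a`. In particular `Ω` lies locally on one side of its
boundary. -/
def IsLocalDefiningFunction {d : ℕ} (Ω : Set (EuclideanSpace ℝ (Fin d)))
    (a : EuclideanSpace ℝ (Fin d)) (ρ : EuclideanSpace ℝ (Fin d) → ℝ) : Prop :=
  ∃ U : Set (EuclideanSpace ℝ (Fin d)), IsOpen U ∧ a ∈ U ∧ ContDiffOn ℝ 1 ρ U ∧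
    gradient ρ a ≠ 0 ∧ ∀ x ∈ U, (x ∈ Ω ↔ ρ x < 0)

/-- The boundary of `Ω` is of class `C¹`. -/
def HasC1Boundary {d : ℕ} (Ω : Set (EuclideanSpace ℝ (Fin d))) : Prop :=
  ∀ a ∈ frontier Ω, ∃ ρ : EuclideanSpace ℝ (Fin d) → ℝ, IsLocalDefiningFunction Ω a ρ

open Classical in
/-- The outward unit normal `n(a)` at a boundary point `a`: the normalized gradient of a local
defining function. It does not depend on the choice of that function, see
`outwardNormal_eq` below. -/
def outwardNormal {d : ℕ} (Ω : Set (EuclideanSpace ℝ (Fin d)))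
    (a : EuclideanSpace ℝ (Fin d)) : EuclideanSpace ℝ (Fin d) :=
  if h : ∃ ρ : EuclideanSpace ℝ (Fin d) → ℝ, IsLocalDefiningFunction Ω a ρ then
    ‖gradient h.choose a‖⁻¹ • gradient h.choose a
  else 0

/-- The backward exit time `τ₋(x, v) = inf {s > 0 : x - s v ∉ Ω}`. (For bounded `Ω` and `v ≠ 0`
the set is non-empty.) -/
def exitTime {d : ℕ} (Ω : Set (EuclideanSpace ℝ (Fin d)))
    (x v : EuclideanSpace ℝ (Fin d)) : ℝ :=
  sInf {s : ℝ | 0 < s ∧ x - s • v ∉ Ω}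

/-- The unit vector `(x - y) / |x - y|` (zero when `x = y`). -/
def direction {d : ℕ} (x y : EuclideanSpace ℝ (Fin d)) : EuclideanSpace ℝ (Fin d) :=
  ‖x - y‖⁻¹ • (x - y)

open Classical in
/-- The density `J(x, y)` with respect to the surface measure in `y` of the measure
`|σ · n(x)| dσ` on the half sphere `{σ : σ · n(x) > 0}`, transported by the map
`σ ↦ x - τ₋(x, σ) σ` from directions to exit points. It is carried by those `y` which are the
exit point of the ray leaving `x` in direction `-σ`, `σ = (x - y) / |x - y|`, with
`σ · n(x) > 0` and `σ · n(y) < 0`. -/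
def kernelJ {d : ℕ} (Ω : Set (EuclideanSpace ℝ (Fin d)))
    (x y : EuclideanSpace ℝ (Fin d)) : ℝ :=
  if 0 < inner ℝ (x - y) (outwardNormal Ω x) ∧ inner ℝ (x - y) (outwardNormal Ω y) < 0 ∧
      y = x - exitTime Ω x (direction x y) • direction x y then
    |inner ℝ (x - y) (outwardNormal Ω x)| / ‖x - y‖ ^ (d + 1) *
      |inner ℝ (x - y) (outwardNormal Ω y)|
  else 0

/-- The Lebesgue surface measure `π` on the boundary of `Ω`: the `(d - 1)`-dimensional Hausdorff
measure, in the normalization that agrees with Lebesgue measure on hyperplanes, restricted to the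
boundary. -/
def surfaceMeasure {d : ℕ} (Ω : Set (EuclideanSpace ℝ (Fin d))) :
    Measure (EuclideanSpace ℝ (Fin d)) :=
  (Measure.euclideanHausdorffMeasure (d - 1)).restrict (frontier Ω)

/-- A direction along which one defining function decreases strictly is a direction along which
no other defining function increases strictly. -/
theorem inner_gradient_nonpos {d : ℕ} {Ω : Set (EuclideanSpace ℝ (Fin d))}
    {a v : EuclideanSpace ℝ (Fin d)} {ρ₁ ρ₂ : EuclideanSpace ℝ (Fin d) → ℝ}
    (h₁ : IsLocalDefiningFunction Ω a ρ₁) (h₂ : IsLocalDefiningFunction Ω a ρ₂)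
    (ha₁ : ρ₁ a = 0) (ha₂ : ρ₂ a = 0)
    (hv : inner ℝ (gradient ρ₁ a) v < 0) : inner ℝ (gradient ρ₂ a) v ≤ 0 := by
  have key : ∀ ρ : EuclideanSpace ℝ (Fin d) → ℝ, IsLocalDefiningFunction Ω a ρ →
      HasDerivAt (fun t : ℝ => ρ (a + t • v)) (inner ℝ (gradient ρ a) v) 0 := by
    rintro ρ ⟨U, hU, haU, hc, -, -⟩
    have hd : DifferentiableAt ℝ ρ a :=
      (hc.differentiableOn one_ne_zero).differentiableAt (hU.mem_nhds haU)
    have hg := hd.hasGradientAt.hasFDerivAt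
    have hl : HasDerivAt (fun t : ℝ => a + t • v) v 0 := by
      simpa using ((hasDerivAt_id (0 : ℝ)).smul_const v).const_add a
    have hg' : HasFDerivAt ρ ((InnerProductSpace.toDual ℝ _) (gradient ρ a))
        ((fun t : ℝ => a + t • v) 0) := by simpa using hg
    have hh := hg'.comp_hasDerivAt (0 : ℝ) hl
    rwa [InnerProductSpace.toDual_apply_apply] at hh
  have k₁ := key ρ₁ h₁
  have k₂ := key ρ₂ h₂
  obtain ⟨U₁, hU₁, haU₁, -, -, hs₁⟩ := h₁
  obtain ⟨U₂, hU₂, haU₂, -, -, hs₂⟩ := h₂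
  by_contra! hpos
  have hcont : Tendsto (fun t : ℝ => a + t • v) (𝓝[>] 0) (𝓝 a) := by
    have : Continuous (fun t : ℝ => a + t • v) := by fun_prop
    simpa using (this.tendsto 0).mono_left nhdsWithin_le_nhds
  have e₁ := hcont.eventually (hU₁.mem_nhds haU₁)
  have e₂ := hcont.eventually (hU₂.mem_nhds haU₂)
  have hs₁' := (hasDerivAt_iff_tendsto_slope.1 k₁).mono_left
    (nhdsWithin_mono 0 (fun t (ht : 0 < t) => ht.ne'))
  have hs₂' := (hasDerivAt_iff_tendsto_slope.1 k₂).mono_left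
    (nhdsWithin_mono 0 (fun t (ht : 0 < t) => ht.ne'))
  have f₁ := hs₁'.eventually (gt_mem_nhds hv)
  have f₂ := hs₂'.eventually (lt_mem_nhds hpos)
  obtain ⟨t, ht₁, ht₂, hf₁, hf₂, ht⟩ :=
    (e₁.and (e₂.and (f₁.and (f₂.and self_mem_nhdsWithin)))).exists
  have ht : (0 : ℝ) < t := ht
  simp only [slope_def_field, sub_zero, zero_smul, add_zero, ha₁, ha₂] at hf₁ hf₂
  have n₁ : ρ₁ (a + t • v) < 0 := by
    by_contra! h
    exact absurd hf₁ (not_lt.2 (div_nonneg h ht.le))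
  have n₂ : 0 < ρ₂ (a + t • v) := by
    by_contra! h
    exact absurd hf₂ (not_lt.2 (div_nonpos_of_nonpos_of_nonneg h ht.le))
  exact absurd ((hs₂ _ ht₂).1 ((hs₁ _ ht₁).2 n₁)) (not_lt.2 n₂.le)

/-- A local defining function vanishes at the boundary point. -/
theorem IsLocalDefiningFunction.eq_zero {d : ℕ} {Ω : Set (EuclideanSpace ℝ (Fin d))}
    {a : EuclideanSpace ℝ (Fin d)} {ρ : EuclideanSpace ℝ (Fin d) → ℝ}
    (h : IsLocalDefiningFunction Ω a ρ) (hΩ : IsOpen Ω) (ha : a ∈ frontier Ω) : ρ a = 0 := by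
  obtain ⟨U, hU, haU, hc, -, hs⟩ := h
  have hca : ContinuousAt ρ a := hc.continuousOn.continuousAt (hU.mem_nhds haU)
  have hna : a ∉ Ω := by
    rw [hΩ.frontier_eq] at ha
    exact ha.2
  refine le_antisymm ?_ (not_lt.1 fun hlt => hna ((hs a haU).2 hlt))
  by_contra! hpos
  have h1 := (hca.eventually (lt_mem_nhds hpos)).and (hU.mem_nhds haU)
  obtain ⟨x, ⟨hx, hxU⟩, hxΩ⟩ :=
    mem_closure_iff_nhds.1 (frontier_subset_closure ha) _ h1
  exact absurd ((hs x hxU).1 hxΩ) (not_lt.2 (le_of_lt hx))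

/-- The outward unit normal does not depend on the defining function. -/
theorem outwardNormal_eq {d : ℕ} {Ω : Set (EuclideanSpace ℝ (Fin d))}
    {a : EuclideanSpace ℝ (Fin d)} {ρ : EuclideanSpace ℝ (Fin d) → ℝ}
    (hΩ : IsOpen Ω) (ha : a ∈ frontier Ω) (h : IsLocalDefiningFunction Ω a ρ) :
    outwardNormal Ω a = ‖gradient ρ a‖⁻¹ • gradient ρ a := by
  have hex : ∃ ρ : EuclideanSpace ℝ (Fin d) → ℝ, IsLocalDefiningFunction Ω a ρ := ⟨ρ, h⟩
  rw [outwardNormal, dif_pos hex]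
  have h' := hex.choose_spec
  generalize hex.choose = ρ' at h'
  have z := h.eq_zero hΩ ha
  have z' := h'.eq_zero hΩ ha
  have g : gradient ρ a ≠ 0 := h.choose_spec.2.2.2.1
  have g' : gradient ρ' a ≠ 0 := h'.choose_spec.2.2.2.1
  by_contra hne
  have u : ‖‖gradient ρ a‖⁻¹ • gradient ρ a‖ = 1 := norm_smul_inv_norm (𝕜 := ℝ) g
  have u' : ‖‖gradient ρ' a‖⁻¹ • gradient ρ' a‖ = 1 := norm_smul_inv_norm (𝕜 := ℝ) g'
  set m := ‖gradient ρ a‖⁻¹ • gradient ρ a with hm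
  set m' := ‖gradient ρ' a‖⁻¹ • gradient ρ' a with hm'
  have lt1 : inner ℝ m' m < 1 := (inner_lt_one_iff_real_of_norm_eq_one u' u).2 hne
  have e : gradient ρ a = ‖gradient ρ a‖ • m := by
    rw [hm, smul_smul, mul_inv_cancel₀ (norm_ne_zero_iff.2 g), one_smul]
  have e' : gradient ρ' a = ‖gradient ρ' a‖ • m' := by
    rw [hm', smul_smul, mul_inv_cancel₀ (norm_ne_zero_iff.2 g'), one_smul]
  have p : 0 < ‖gradient ρ a‖ := norm_pos_iff.2 g
  have p' : 0 < ‖gradient ρ' a‖ := norm_pos_iff.2 g'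
  have q : inner ℝ m m = 1 := by rw [real_inner_self_eq_norm_sq, u]; norm_num
  have q' : inner ℝ m' m' = 1 := by rw [real_inner_self_eq_norm_sq, u']; norm_num
  have c : inner ℝ m m' = inner ℝ m' m := real_inner_comm _ _
  have A : inner ℝ (gradient ρ' a) (m - m') < 0 := by
    rw [e', real_inner_smul_left, inner_sub_right, q']
    exact mul_neg_of_pos_of_neg p' (by linarith)
  have B := inner_gradient_nonpos h' h z' z A
  rw [e, real_inner_smul_left, inner_sub_right, q, c] at B
  exact absurd B (not_le.2 (mul_pos p (by linarith)))

end DiffuseBoundary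

end

noncomputable section

namespace DiffuseBoundary

open Module

/-! The kernel is the solid-angle density `|(x - y) · n(x)| / |x - y| ^ d` times the factor `|(x -
y) · n(y)| / |x - y|`. Both endpoints lie on a `C¹` surface, so for short chords this factor is at
most any prescribed `ε`, uniformly by compactness (`exists_forall_abs_inner_outwardNormal_le`). The
density has an integral over the visible boundary that is bounded uniformly in `y`
(`exists_lintegral_visibleFrom_le`): each ray from `y` meets the visible boundary at most once, so
only a bounded solid angle is swept. The integral of the kernel is therefore at most `ε * C`.

The solid angle is bounded without measures on the sphere. A boundary chart over a hyperplane is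
thickened by a transversal coordinate `t ∈ (1/2, 1)`, and `t` serves as the radius in polar
coordinates about `y`. The resulting cone map is injective with values in a unit ball, and its
Jacobian dominates the density up to a constant (`le_abs_det_cone`, `lintegral_cone_le`). The
surface measure is compared with the thickened volume in `restrict_le_map_chart`, and compactness
leaves finitely many charts. -/

/-! ### Linear algebra and calculus of the cone map -/

/-- The derivative of a map that is polar in one direction, composed with a left inverse `B` of the
derivative `A` of a chart, has an explicit determinant; this bounds its own from below. -/
theorem le_abs_det_cone {E : Type*} [NormedAddCommGroup E] [InnerProductSpace ℝ E]
    [FiniteDimensional ℝ E] {n g e : E} {s : ℝ} (hn : ‖n‖ = 1) (hs : 0 < s)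
    {A F : E →ₗ[ℝ] E}
    (hA : ∀ h, A h - inner ℝ n (A h) • n + inner ℝ g (A h) • n = h)
    (hF : ∀ h, F h = inner ℝ n h • e + s • (A (h - inner ℝ n h • n)
      - inner ℝ e (A (h - inner ℝ n h • n)) • e)) :
    s ^ (finrank ℝ E - 1) * |inner ℝ (‖g‖⁻¹ • g) e| ≤ |LinearMap.det F| := by
  have hnn : inner ℝ n n = 1 := by rw [real_inner_self_eq_norm_sq, hn]; norm_num
  have hpos : 0 < finrank ℝ E := by
    have : Nontrivial E := ⟨n, 0, fun h => by simp [h] at hn⟩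
    exact finrank_pos
  let ι : E → (E →ₗ[ℝ] ℝ) := fun v => (innerSL ℝ v).toLinearMap
  let B : E →ₗ[ℝ] E := LinearMap.transvection (ι (g - n)) n
  let f : E →ₗ[ℝ] ℝ := -s • (ι e ∘ₗ A ∘ₗ LinearMap.transvection (ι (-n)) n)
  let T : E →ₗ[ℝ] E := LinearMap.transvection f n
  let w : E := B e
  -- `N` sends `n` to `B e` and multiplies the complement `n⊥` by `s`. The shear `T` absorbs the
  -- radial correction in `F`, so `B ∘ F = N ∘ T`, that is, `⟪g, n⟫ * det F = s ^ (dim - 1) * ⟪g,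
  -- e⟫`.
  let N : E →ₗ[ℝ] E := s • LinearMap.transvection (ι n) (s⁻¹ • w - n)
  have hB : ∀ h, B h = h - inner ℝ n h • n + inner ℝ g h • n := fun h => by
    simp [B, ι, LinearMap.transvection.apply, sub_smul]; abel
  have hnw : inner ℝ n w = inner ℝ g e := by
    simp only [w, hB, inner_add_right, inner_sub_right, real_inner_smul_right, hnn]; ring
  have hdB : LinearMap.det B = inner ℝ g n := by
    simp [B, ι, hn]
  have hfn : f n = 0 := by
    simp [f, ι, LinearMap.transvection.apply, hn]
  have hdT : LinearMap.det T = 1 := by simp [T, hfn]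
  have hdN : LinearMap.det N = s ^ (finrank ℝ E - 1) * inner ℝ g e := by
    have e1 : s ^ finrank ℝ E = s ^ (finrank ℝ E - 1) * s := by
      rw [← pow_succ, Nat.sub_add_cancel hpos]
    simp only [N, LinearMap.det_smul, LinearMap.transvection.det, ι]
    simp only [ContinuousLinearMap.coe_coe, innerSL_apply_apply, inner_sub_right,
      real_inner_smul_right, hnn, hnw, e1]
    field_simp
    ring
  have hcomp : B ∘ₗ F = N ∘ₗ T := by
    ext h
    have hfh : f h = - (s * inner ℝ e (A (h - inner ℝ n h • n))) := by
      simp [f, ι, LinearMap.transvection.apply, sub_eq_add_neg]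
    have hBF : B (F h) = inner ℝ n h • w + s • ((h - inner ℝ n h • n)
        - inner ℝ e (A (h - inner ℝ n h • n)) • w) := by
      rw [hF, map_add, map_smul, map_smul, map_sub, map_smul, hB (A _), hA]
    have hNT : N (T h) = s • (T h + inner ℝ n (T h) • (s⁻¹ • w - n)) := by
      simp [N, ι, LinearMap.transvection.apply]
    have hT : T h = h + f h • n := by simp [T, LinearMap.transvection.apply]
    simp only [LinearMap.comp_apply]
    rw [hBF, hNT, hT, inner_add_right, real_inner_smul_right, hnn, hfh]
    generalize inner ℝ e (A (h - inner ℝ n h • n)) = c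
    generalize inner ℝ n h = b
    match_scalars <;> field_simp <;> ring
  have hdet := congrArg LinearMap.det hcomp
  rw [LinearMap.det_comp, LinearMap.det_comp, hdB, hdN, hdT, mul_one] at hdet
  have hdet' := congrArg abs hdet
  rw [abs_mul, abs_mul, abs_of_pos (pow_pos hs _)] at hdet'
  rw [real_inner_smul_left, abs_mul, abs_of_nonneg (inv_nonneg.2 (norm_nonneg g)),
    mul_left_comm, ← hdet', ← mul_assoc]
  -- What remains is `|⟪g, n⟫| / ‖g‖ ≤ 1`, by Cauchy–Schwarz; with `0⁻¹ = 0` it also covers `g = 0`.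
  refine mul_le_of_le_one_left (abs_nonneg _) ?_
  have h1 : |inner ℝ g n| ≤ ‖g‖ := by simpa [hn] using abs_real_inner_le_norm g n
  calc ‖g‖⁻¹ * |inner ℝ g n| ≤ ‖g‖⁻¹ * ‖g‖ := by gcongr
    _ ≤ 1 := inv_mul_le_one

/-- The derivative of the radial projection onto the unit sphere. -/
theorem hasFDerivAt_inv_norm_smul {E : Type*} [NormedAddCommGroup E] [InnerProductSpace ℝ E]
    {v : E} (hv : v ≠ 0) :
    HasFDerivAt (fun v : E => ‖v‖⁻¹ • v)
      (‖v‖⁻¹ • (ContinuousLinearMap.id ℝ E -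
        (innerSL ℝ (‖v‖⁻¹ • v)).smulRight (‖v‖⁻¹ • v))) v := by
  have h0 : ‖v‖ ≠ 0 := norm_ne_zero_iff.2 hv
  have h1 : HasFDerivAt (fun v : E => ‖v‖) (‖v‖⁻¹ • innerSL ℝ v) v := by
    have h2 := ((hasStrictFDerivAt_norm_sq v).hasFDerivAt).sqrt (pow_ne_zero 2 h0)
    simp only [Real.sqrt_sq (norm_nonneg _)] at h2
    convert h2 using 1
    ext h
    simp
    field_simp
  have h3 : HasFDerivAt (fun v : E => ‖v‖⁻¹ • v) _ v :=
    ((hasDerivAt_inv h0).comp_hasFDerivAt v h1).smul (hasFDerivAt_id v)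
  convert h3 using 1
  ext h
  simp
  match_scalars <;> field_simp

/-! ### Slicing a cylinder over a hyperplane -/

/-- The Hausdorff measure of a subset of a hyperplane, bounded by the volume of a cylinder. -/
theorem euclideanHausdorffMeasure_le_cylinder {E : Type*} [NormedAddCommGroup E]
    [InnerProductSpace ℝ E] [FiniteDimensional ℝ E] [MeasurableSpace E] [BorelSpace E]
    {n : E} (hn : ‖n‖ = 1) {D : Set E} (hD : ∀ p ∈ D, inner ℝ n p = 0)
    (hm : MeasurableSet {z : E | inner ℝ n z ∈ Set.Ioo (1 / 2 : ℝ) 1 ∧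
      z - inner ℝ n z • n ∈ D}) :
    Measure.euclideanHausdorffMeasure (finrank ℝ E - 1) D ≤
      2 * Measure.euclideanHausdorffMeasure (finrank ℝ E)
        {z : E | inner ℝ n z ∈ Set.Ioo (1 / 2 : ℝ) 1 ∧ z - inner ℝ n z • n ∈ D} := by
  have hnn : inner ℝ n n = 1 := by rw [real_inner_self_eq_norm_sq, hn]; norm_num
  have hn0 : n ≠ 0 := fun h => by simp [h] at hn
  rw [EuclideanGeometry.euclideanHausdorffMeasure_eq_lintegral (0 : E) hn0 hm]
  have hne : ‖n‖ₑ = 1 := by rw [← ofReal_norm, hn]; simp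
  rw [hne, one_mul]
  set ν : Measure E := Measure.euclideanHausdorffMeasure (finrank ℝ E - 1)
  -- Each slice of the cylinder contains a translate of `D`. The factor 2 is the inverse length of
  -- `(1/2, 1)`, a range that keeps the later polar radius away from 0 and below 1.
  calc ν D = 2 * ∫⁻ _ in Set.Ioo (1 / 2 : ℝ) 1, ν D := by
        rw [setLIntegral_const, Real.volume_Ioo, mul_left_comm,
          ← ENNReal.ofReal_ofNat 2, ← ENNReal.ofReal_mul (by norm_num)]
        norm_num
    _ ≤ 2 * ∫⁻ x in Set.Ioo (1 / 2 : ℝ) 1, ν ({z : E | inner ℝ n z ∈ Set.Ioo (1 / 2 : ℝ) 1 ∧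
        z - inner ℝ n z • n ∈ D} ∩
          AffineSubspace.mk' (x • n +ᵥ (0 : E)) (Submodule.span ℝ {n})ᗮ) := by
        gcongr 2 * ?_
        refine setLIntegral_mono' measurableSet_Ioo fun x hx => ?_
        rw [← measure_vadd ν (x • n) D]
        refine measure_mono ?_
        rintro _ ⟨p, hp, rfl⟩
        have hi : inner ℝ n (x • n + p) = x := by
          rw [inner_add_right, real_inner_smul_right, hnn, hD p hp]; ring
        simp only [vadd_eq_add, Set.mem_inter_iff, Set.mem_ofPred_eq, hi]
        refine ⟨⟨hx, by simpa using hp⟩, ?_⟩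
        simp [AffineSubspace.mem_mk', Submodule.mem_orthogonal_singleton_iff_inner_right, hD p hp]
    _ ≤ _ := by
        gcongr 2 * ?_
        exact setLIntegral_le_lintegral _ _

/-! ### Local structure of a `C¹` boundary: charts and chords -/

theorem IsLocalDefiningFunction.contDiffAt {d : ℕ} {Ω : Set (EuclideanSpace ℝ (Fin d))}
    {a : EuclideanSpace ℝ (Fin d)} {ρ : EuclideanSpace ℝ (Fin d) → ℝ}
    (h : IsLocalDefiningFunction Ω a ρ) : ContDiffAt ℝ 1 ρ a := by
  obtain ⟨U, hU, haU, hc, -, -⟩ := h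
  exact hc.contDiffAt (hU.mem_nhds haU)

theorem IsLocalDefiningFunction.gradient_ne_zero {d : ℕ} {Ω : Set (EuclideanSpace ℝ (Fin d))}
    {a : EuclideanSpace ℝ (Fin d)} {ρ : EuclideanSpace ℝ (Fin d) → ℝ}
    (h : IsLocalDefiningFunction Ω a ρ) : gradient ρ a ≠ 0 := by
  obtain ⟨U, hU, haU, hc, hg, -⟩ := h
  exact hg

theorem IsLocalDefiningFunction.hasStrictFDerivAt {d : ℕ} {Ω : Set (EuclideanSpace ℝ (Fin d))}
    {a : EuclideanSpace ℝ (Fin d)} {ρ : EuclideanSpace ℝ (Fin d) → ℝ}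
    (h : IsLocalDefiningFunction Ω a ρ) :
    HasStrictFDerivAt ρ (innerSL ℝ (gradient ρ a)) a := by
  have h1 := h.contDiffAt
  exact h1.hasStrictFDerivAt'
    (h1.differentiableAt one_ne_zero).hasGradientAt.hasFDerivAt one_ne_zero

theorem IsLocalDefiningFunction.continuousAt_gradient {d : ℕ}
    {Ω : Set (EuclideanSpace ℝ (Fin d))}
    {a : EuclideanSpace ℝ (Fin d)} {ρ : EuclideanSpace ℝ (Fin d) → ℝ}
    (h : IsLocalDefiningFunction Ω a ρ) : ContinuousAt (gradient ρ) a := by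
  have h1 : ContinuousAt (fderiv ℝ ρ) a := by
    obtain ⟨U, hU, haU, hc, -, -⟩ := h
    exact (hc.continuousOn_fderiv_of_isOpen hU le_rfl).continuousAt (hU.mem_nhds haU)
  exact (InnerProductSpace.toDual ℝ _).symm.continuous.continuousAt.comp h1

/-- A local defining function at `a` is one at all nearby points. -/
theorem IsLocalDefiningFunction.eventually {d : ℕ} {Ω : Set (EuclideanSpace ℝ (Fin d))}
    {a : EuclideanSpace ℝ (Fin d)} {ρ : EuclideanSpace ℝ (Fin d) → ℝ}
    (h : IsLocalDefiningFunction Ω a ρ) : ∀ᶠ x in 𝓝 a, IsLocalDefiningFunction Ω x ρ := by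
  have h1 := h.continuousAt_gradient.eventually_ne h.gradient_ne_zero
  obtain ⟨U, hU, haU, hc, -, hs⟩ := h
  filter_upwards [h1, hU.mem_nhds haU] with x hx hxU
  exact ⟨U, hU, hxU, hc, hx, hs⟩

/-- Near a boundary point, the boundary is parametrized by a hyperplane orthogonal to a unit
vector `n`, through a Lipschitz differentiable map `ψ` defined near the hyperplane, whose
derivative inverts `h ↦ h - ⟪n, h⟫ n + ⟪g, h⟫ n` for a vector `g` along the outward normal. -/
theorem exists_boundary_chart {d : ℕ} {Ω : Set (EuclideanSpace ℝ (Fin d))}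
    (hΩ : IsOpen Ω) (hC : HasC1Boundary Ω) {a : EuclideanSpace ℝ (Fin d)} (ha : a ∈ frontier Ω) :
    ∃ (n : EuclideanSpace ℝ (Fin d)) (ψ : EuclideanSpace ℝ (Fin d) → EuclideanSpace ℝ (Fin d))
      (W V : Set (EuclideanSpace ℝ (Fin d))) (K : NNReal),
      ‖n‖ = 1 ∧ IsOpen W ∧ IsOpen V ∧ a ∈ V ∧ LipschitzOnWith K ψ W ∧ Set.InjOn ψ W ∧
      (∀ w ∈ W, ψ w ∈ frontier Ω →
        ∃ (A : EuclideanSpace ℝ (Fin d) →L[ℝ] EuclideanSpace ℝ (Fin d))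
          (g : EuclideanSpace ℝ (Fin d)), HasFDerivAt ψ A w ∧
          (∀ h, A h - inner ℝ n (A h) • n + inner ℝ g (A h) • n = h) ∧
          outwardNormal Ω (ψ w) = ‖g‖⁻¹ • g) ∧
      ∀ x ∈ V, x ∈ frontier Ω → x - inner ℝ n x • n ∈ W ∧ ψ (x - inner ℝ n x • n) = x := by
  obtain ⟨ρ, hρ⟩ := hC a ha
  have hg0 := hρ.gradient_ne_zero
  set n : EuclideanSpace ℝ (Fin d) := ‖gradient ρ a‖⁻¹ • gradient ρ a with hn_def
  have hn : ‖n‖ = 1 := norm_smul_inv_norm (𝕜 := ℝ) hg0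
  let L : EuclideanSpace ℝ (Fin d) → EuclideanSpace ℝ (Fin d) →L[ℝ] EuclideanSpace ℝ (Fin d) :=
    fun g => ContinuousLinearMap.id ℝ _ - (innerSL ℝ n).smulRight n + (innerSL ℝ g).smulRight n
  have hL : ∀ g h, L g h = h - inner ℝ n h • n + inner ℝ g h • n := fun g h => by simp [L]
  -- `Ψ` replaces the coordinate along `n` by `ρ`, which flattens the boundary into the hyperplane
  -- `n⊥`; the chart `ψ` is its local inverse.
  let Ψ : EuclideanSpace ℝ (Fin d) → EuclideanSpace ℝ (Fin d) :=
    fun x => x - inner ℝ n x • n + ρ x • n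
  have hΨ : ∀ x, IsLocalDefiningFunction Ω x ρ → HasStrictFDerivAt Ψ (L (gradient ρ x)) x := by
    intro x hx
    have h1 : HasStrictFDerivAt (fun x => inner ℝ n x • n) ((innerSL ℝ n).smulRight n) x :=
      ((innerSL ℝ n).smulRight n).hasStrictFDerivAt
    exact ((hasStrictFDerivAt_id x).sub h1).add (hx.hasStrictFDerivAt.smul_const n)
  have hΨc : ContDiffAt ℝ 1 Ψ a := by
    have h1 : ContDiffAt ℝ 1 (fun x => inner ℝ n x • n) a :=
      ((innerSL ℝ n).smulRight n).contDiff.contDiffAt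
    exact (contDiffAt_id.sub h1).add (hρ.contDiffAt.smul contDiffAt_const)
  -- The determinant is `1 + ⟪∇ρ a - n, n⟫ = ‖∇ρ a‖`.
  have hdet : (L (gradient ρ a)).det ≠ 0 := by
    have h1 : (L (gradient ρ a) : EuclideanSpace ℝ (Fin d) →ₗ[ℝ] EuclideanSpace ℝ (Fin d)) =
        LinearMap.transvection (innerSL ℝ (gradient ρ a - n)).toLinearMap n := by
      ext1 h
      simp only [LinearMap.transvection.apply, ContinuousLinearMap.coe_coe, hL,
        innerSL_apply_apply, inner_sub_left, sub_smul]
      abel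
    rw [ContinuousLinearMap.det, h1, LinearMap.transvection.det]
    simp only [ContinuousLinearMap.coe_coe, innerSL_apply_apply, inner_sub_left,
      real_inner_self_eq_norm_sq n, hn]
    rw [hn_def, real_inner_smul_right, real_inner_self_eq_norm_sq]
    have := norm_pos_iff.2 hg0
    have : ‖gradient ρ a‖⁻¹ * ‖gradient ρ a‖ ^ 2 = ‖gradient ρ a‖ := by field_simp
    rw [this]
    simpa using hg0
  let L' := (L (gradient ρ a)).toContinuousLinearEquivOfDetNeZero hdet
  have hΨ' : HasFDerivAt Ψ (L' : EuclideanSpace ℝ (Fin d) →L[ℝ] EuclideanSpace ℝ (Fin d)) a := by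
    simpa [L'] using (hΨ a hρ).hasFDerivAt
  have hstr := hΨc.hasStrictFDerivAt' hΨ' one_ne_zero
  set ψ := hΨc.localInverse hΨ' one_ne_zero with hψ
  have hψc : ContDiffAt ℝ 1 ψ (Ψ a) := hΨc.to_localInverse hΨ' one_ne_zero
  have hψa : ψ (Ψ a) = a := hΨc.localInverse_apply_image hΨ' one_ne_zero
  obtain ⟨K, s, hs, hK⟩ := hψc.exists_lipschitzOnWith
  have hright : ∀ᶠ w in 𝓝 (Ψ a), Ψ (ψ w) = w := hstr.eventually_right_inverse
  have hleft : ∀ᶠ x in 𝓝 a, ψ (Ψ x) = x := hstr.eventually_left_inverse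
  have hψd : ∀ᶠ w in 𝓝 (Ψ a), DifferentiableAt ℝ ψ w :=
    (hψc.eventually (by simp)).mono fun w hw => hw.differentiableAt one_ne_zero
  have hψU : ∀ᶠ w in 𝓝 (Ψ a), IsLocalDefiningFunction Ω (ψ w) ρ := by
    have h0 : Tendsto ψ (𝓝 (Ψ a)) (𝓝 (ψ (Ψ a))) := hψc.continuousAt
    rw [hψa] at h0
    exact h0.eventually hρ.eventually
  obtain ⟨W, hWsub, hWo, haW⟩ := mem_nhds_iff.1
    (((hright.and hψd).and hψU).and (show ∀ᶠ w in 𝓝 (Ψ a), w ∈ s from hs))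
  have hΨW : ∀ᶠ x in 𝓝 a, Ψ x ∈ W := hΨc.continuousAt.eventually (hWo.mem_nhds haW)
  obtain ⟨V, hVsub, hVo, haV⟩ := mem_nhds_iff.1 ((hleft.and hΨW).and hρ.eventually)
  refine ⟨n, ψ, W, V, K, hn, hWo, hVo, haV, hK.mono fun w hw => (hWsub hw).2, ?_, ?_, ?_⟩
  · intro w hw w' hw' he
    rw [← (hWsub hw).1.1.1, ← (hWsub hw').1.1.1, he]
  · intro w hw hwf
    obtain ⟨⟨⟨-, hd⟩, hU⟩, -⟩ := hWsub hw
    refine ⟨fderiv ℝ ψ w, gradient ρ (ψ w), hd.hasFDerivAt, fun h => ?_,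
      outwardNormal_eq hΩ hwf hU⟩
    -- Differentiating `Ψ ∘ ψ = id` gives the inversion identity for the derivative of `ψ`.
    have h1 := (hΨ _ hU).hasFDerivAt.comp w hd.hasFDerivAt
    have h2 : HasFDerivAt (Ψ ∘ ψ) (ContinuousLinearMap.id ℝ _) w := by
      refine (hasFDerivAt_id w).congr_of_eventuallyEq ?_
      filter_upwards [hWo.mem_nhds hw] with w' hw'
      exact (hWsub hw').1.1.1
    have h3 := congrArg (fun T => T h) (h1.unique h2)
    simpa [hL] using h3
  · intro x hx hxf
    obtain ⟨⟨h1, h2⟩, h3⟩ := hVsub hx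
    -- On the boundary `ρ` vanishes, so `Ψ` is there the orthogonal projection onto `n⊥`.
    have h4 : Ψ x = x - inner ℝ n x • n := by simp [Ψ, h3.eq_zero hΩ hxf]
    rw [← h4]
    exact ⟨h2, h1⟩

/-- Chords of the boundary near a given point are almost orthogonal to the normal. -/
theorem eventually_abs_inner_outwardNormal_le {d : ℕ} {Ω : Set (EuclideanSpace ℝ (Fin d))}
    (hΩ : IsOpen Ω) (hC : HasC1Boundary Ω) {a : EuclideanSpace ℝ (Fin d)} (ha : a ∈ frontier Ω)
    {ε : ℝ} (hε : 0 < ε) :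
    ∀ᶠ p : EuclideanSpace ℝ (Fin d) × EuclideanSpace ℝ (Fin d) in 𝓝 (a, a),
      p.1 ∈ frontier Ω → p.2 ∈ frontier Ω →
        |inner ℝ (p.1 - p.2) (outwardNormal Ω p.2)| ≤ ε * ‖p.1 - p.2‖ := by
  obtain ⟨ρ, hρ⟩ := hC a ha
  set g := gradient ρ a with hg
  have hg0 : 0 < ‖g‖ := norm_pos_iff.2 hρ.gradient_ne_zero
  -- Strict differentiability at `a` and the variation of the gradient each cost `η`; dividing by
  -- `‖∇ρ y‖ > ‖g‖ / 2` turns `2 * η` into `ε`.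
  set η := ε * ‖g‖ / 4 with hη
  have hη0 : 0 < η := by positivity
  have h1 := hρ.hasStrictFDerivAt.isLittleO.def hη0
  have hfst : Tendsto Prod.fst (𝓝 (a, a)) (𝓝 a) := continuous_fst.tendsto (a, a)
  have hsnd : Tendsto Prod.snd (𝓝 (a, a)) (𝓝 a) := continuous_snd.tendsto (a, a)
  have h2 : ∀ᶠ x in 𝓝 a, ‖gradient ρ x - g‖ < η := by
    have := hρ.continuousAt_gradient.eventually (Metric.ball_mem_nhds _ hη0)
    simpa [dist_eq_norm] using this
  have h3 : ∀ᶠ x in 𝓝 a, ‖g‖ / 2 < ‖gradient ρ x‖ :=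
    hρ.continuousAt_gradient.norm.eventually (lt_mem_nhds (by linarith))
  filter_upwards [h1, hfst.eventually hρ.eventually, hsnd.eventually (hρ.eventually.and (h2.and h3))]
    with ⟨x, y⟩ k1 k2 ⟨k3, k4, k5⟩ hx hy
  simp only at k1 k2 k3 k4 k5 hx hy ⊢
  rw [k2.eq_zero hΩ hx, k3.eq_zero hΩ hy, sub_zero, zero_sub, norm_neg, innerSL_apply_apply,
    Real.norm_eq_abs] at k1
  have k6 : |inner ℝ (x - y) (gradient ρ y - g)| ≤ ‖x - y‖ * η :=
    (abs_real_inner_le_norm _ _).trans (by gcongr)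
  have k7 : |inner ℝ (x - y) (gradient ρ y)| ≤ 2 * η * ‖x - y‖ := by
    have : inner ℝ (x - y) (gradient ρ y) =
        inner ℝ (x - y) (gradient ρ y - g) + inner ℝ g (x - y) := by
      rw [inner_sub_right, real_inner_comm g]; ring
    rw [this]
    refine (abs_add_le _ _).trans ?_
    linarith
  have hpos : 0 < ‖gradient ρ y‖ := by linarith
  rw [outwardNormal_eq hΩ hy k3, real_inner_smul_right, abs_mul, abs_inv, abs_norm,
    inv_mul_le_iff₀ hpos]
  refine k7.trans ?_
  have : 2 * η = ε * (‖g‖ / 2) := by rw [hη]; ring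
  rw [this, ← mul_assoc, mul_comm ‖gradient ρ y‖]
  gcongr

/-! ### Visibility and the volume of the cone -/

/-- The points other than `y` that are joined to `y` by an open segment contained in `Ω`. -/
def visibleFrom {E : Type*} [NormedAddCommGroup E] [NormedSpace ℝ E] (Ω : Set E) (y : E) : Set E :=
  {x | x ≠ y ∧ ∀ t ∈ Set.Ioo (0 : ℝ) 1, y + t • (x - y) ∈ Ω}

/-- The visible set of an open set is a Gδ set, hence measurable. -/
theorem measurableSet_visibleFrom {E : Type*} [NormedAddCommGroup E] [NormedSpace ℝ E]
    [MeasurableSpace E] [BorelSpace E] {Ω : Set E} (hΩ : IsOpen Ω) (y : E) :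
    MeasurableSet (visibleFrom Ω y) := by
  -- By the tube lemma, keeping a compact part of the segment inside `Ω` is an open condition; these
  -- parts exhaust the open segment.
  have hopen : ∀ k : ℕ, IsOpen {x : E | ∀ t ∈ Set.Icc (1 / ((k : ℝ) + 1)) (1 - 1 / ((k : ℝ) + 1)),
      y + t • (x - y) ∈ Ω} := fun k => by
    refine isOpen_iff_mem_nhds.2 fun x hx => ?_
    have hc : Continuous fun p : E × ℝ => y + p.2 • (p.1 - y) := by fun_prop
    exact isCompact_Icc.eventually_forall_of_forall_eventually
      fun t ht => hc.continuousAt.eventually (hΩ.mem_nhds (hx t ht))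
  have heq : visibleFrom Ω y = {y}ᶜ ∩ ⋂ k : ℕ,
      {x : E | ∀ t ∈ Set.Icc (1 / ((k : ℝ) + 1)) (1 - 1 / ((k : ℝ) + 1)),
        y + t • (x - y) ∈ Ω} := by
    ext x
    simp only [visibleFrom, Set.mem_ofPred_eq, Set.mem_inter_iff, Set.mem_compl_iff,
      Set.mem_singleton_iff, Set.mem_iInter]
    refine and_congr_right fun _ => ⟨fun h k t ht => h t ⟨?_, ?_⟩, fun h t ht => ?_⟩
    · exact lt_of_lt_of_le Nat.one_div_pos_of_nat ht.1
    · have : (0 : ℝ) < 1 / ((k : ℝ) + 1) := Nat.one_div_pos_of_nat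
      linarith [ht.2]
    · obtain ⟨k, hk⟩ := exists_nat_one_div_lt (lt_min ht.1 (sub_pos.2 ht.2))
      exact h k t ⟨(hk.trans_le (min_le_left _ _)).le, by linarith [hk.trans_le (min_le_right _ _)]⟩
  rw [heq]
  exact (measurableSet_singleton y).compl.inter (.iInter fun k => (hopen k).measurableSet)

/-- Two boundary points seen from `y` in the same direction coincide. -/
theorem eq_of_mem_visibleFrom {E : Type*} [NormedAddCommGroup E] [NormedSpace ℝ E]
    {Ω : Set E} (hΩ : IsOpen Ω) {y x x' : E} (hx : x ∈ visibleFrom Ω y)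
    (hx' : x' ∈ visibleFrom Ω y) (hxf : x ∈ frontier Ω) (hxf' : x' ∈ frontier Ω)
    (h : ‖x - y‖⁻¹ • (x - y) = ‖x' - y‖⁻¹ • (x' - y)) : x = x' := by
  have hn : ∀ z ∈ frontier Ω, z ∉ Ω := fun z hz => by
    rw [hΩ.frontier_eq] at hz
    exact hz.2
  -- The nearer of two points in the same direction would lie on the open segment to the farther
  -- one, hence in `Ω`, which is disjoint from its boundary.
  have key : ∀ u v : E, u ∈ visibleFrom Ω y → v ∈ visibleFrom Ω y → u ∈ frontier Ω →
      ‖u - y‖⁻¹ • (u - y) = ‖v - y‖⁻¹ • (v - y) → ¬ ‖u - y‖ < ‖v - y‖ := by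
    intro u v hu hv huf he hlt
    have hu0 : 0 < ‖u - y‖ := norm_pos_iff.2 (sub_ne_zero.2 hu.1)
    have hv0 := hu0.trans hlt
    refine hn u huf ?_
    have := hv.2 (‖u - y‖ / ‖v - y‖) ⟨div_pos hu0 hv0, (div_lt_one hv0).2 hlt⟩
    rwa [div_eq_mul_inv, mul_smul, ← he, smul_smul, mul_inv_cancel₀ hu0.ne', one_smul,
      add_sub_cancel] at this
  have he : ‖x - y‖ = ‖x' - y‖ :=
    le_antisymm (not_lt.1 (key x' x hx' hx hxf' h.symm)) (not_lt.1 (key x x' hx hx' hxf h))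
  have h0 : ‖x' - y‖⁻¹ ≠ 0 := inv_ne_zero (norm_ne_zero_iff.2 (sub_ne_zero.2 hx'.1))
  rw [he] at h
  exact sub_left_injective (smul_right_injective E h0 h)

/-- The differential of the cone with vertex `y` over a chart, in the direction of the axis `n`. -/
theorem hasFDerivAt_cone {E : Type*} [NormedAddCommGroup E] [InnerProductSpace ℝ E]
    {n y z : E} {ψ : E → E} {A : E →L[ℝ] E} (hψ : HasFDerivAt ψ A (z - inner ℝ n z • n))
    (hy : ψ (z - inner ℝ n z • n) ≠ y) :
    ∃ F : E →L[ℝ] E, HasFDerivAt (fun z => y + inner ℝ n z • ‖ψ (z - inner ℝ n z • n) - y‖⁻¹ •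
        (ψ (z - inner ℝ n z • n) - y)) F z ∧
      ∀ h, F h = inner ℝ n h • (‖ψ (z - inner ℝ n z • n) - y‖⁻¹ • (ψ (z - inner ℝ n z • n) - y)) +
        (inner ℝ n z / ‖ψ (z - inner ℝ n z • n) - y‖) • (A (h - inner ℝ n h • n) -
          inner ℝ (‖ψ (z - inner ℝ n z • n) - y‖⁻¹ • (ψ (z - inner ℝ n z • n) - y))
            (A (h - inner ℝ n h • n)) •
            (‖ψ (z - inner ℝ n z • n) - y‖⁻¹ • (ψ (z - inner ℝ n z • n) - y))) := by
  have h1 : HasFDerivAt (fun z : E => z - inner ℝ n z • n)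
      (ContinuousLinearMap.id ℝ E - (innerSL ℝ n).smulRight n) z :=
    (hasFDerivAt_id z).sub ((innerSL ℝ n).smulRight n).hasFDerivAt
  have h2 := (hψ.comp z h1).sub_const y
  have h3 := (hasFDerivAt_inv_norm_smul (sub_ne_zero.2 hy)).comp z h2
  have h4 : HasFDerivAt (fun z : E => inner ℝ n z) (innerSL ℝ n) z := (innerSL ℝ n).hasFDerivAt
  have h5 := (h4.smul h3).const_add y
  refine ⟨_, h5, fun h => ?_⟩
  simp only [add_apply, smul_apply, ContinuousLinearMap.comp_apply,
    ContinuousLinearMap.smulRight_apply, sub_apply, ContinuousLinearMap.id_apply,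
    innerSL_apply_apply, Function.comp_apply]
  rw [add_comm, div_eq_mul_inv, mul_smul]

/-- The solid angle covered by the part of a chart visible from `y` is bounded: the cone over it,
truncated to the unit ball, has bounded volume. -/
theorem lintegral_cone_le {E : Type*} [NormedAddCommGroup E] [InnerProductSpace ℝ E]
    [FiniteDimensional ℝ E] [MeasurableSpace E] [BorelSpace E] {n : E} (hn : ‖n‖ = 1)
    {ψ : E → E} {W : Set E} (hinj : Set.InjOn ψ W) {Ω : Set E} (hΩ : IsOpen Ω) {N : E → E}
    (hψ : ∀ w ∈ W, ψ w ∈ frontier Ω → ∃ (A : E →L[ℝ] E) (g : E), HasFDerivAt ψ A w ∧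
      (∀ h, A h - inner ℝ n (A h) • n + inner ℝ g (A h) • n = h) ∧ N (ψ w) = ‖g‖⁻¹ • g)
    {y : E} {T : Set E} (hT : MeasurableSet T)
    (hTsub : ∀ z ∈ T, inner ℝ n z ∈ Set.Ioo (1 / 2 : ℝ) 1 ∧ z - inner ℝ n z • n ∈ W ∧
      ψ (z - inner ℝ n z • n) ∈ visibleFrom Ω y ∧ ψ (z - inner ℝ n z • n) ∈ frontier Ω) :
    ∫⁻ z in T, ENNReal.ofReal (|inner ℝ (ψ (z - inner ℝ n z • n) - y)
        (N (ψ (z - inner ℝ n z • n)))| / ‖ψ (z - inner ℝ n z • n) - y‖ ^ finrank ℝ E)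
        ∂(Measure.euclideanHausdorffMeasure (finrank ℝ E)) ≤
      ENNReal.ofReal (2 ^ (finrank ℝ E - 1)) *
        Measure.euclideanHausdorffMeasure (finrank ℝ E) (Metric.closedBall (0 : E) 1) := by
  set μ : Measure E := Measure.euclideanHausdorffMeasure (finrank ℝ E)
  -- The projection of `z` along `n` selects a boundary point, hence a direction from `y`; the
  -- coordinate of `z` along `n` is the distance travelled.
  let Φ : E → E := fun z => y + inner ℝ n z • ‖ψ (z - inner ℝ n z • n) - y‖⁻¹ •
        (ψ (z - inner ℝ n z • n) - y)
  have hdim : 0 < finrank ℝ E := by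
    have : Nontrivial E := ⟨n, 0, fun h => by simp [h] at hn⟩
    exact finrank_pos
  have hΦ : ∀ z, ∃ F : E →L[ℝ] E, z ∈ T → HasFDerivAt Φ F z ∧
      |inner ℝ (ψ (z - inner ℝ n z • n) - y) (N (ψ (z - inner ℝ n z • n)))| /
        ‖ψ (z - inner ℝ n z • n) - y‖ ^ finrank ℝ E ≤ 2 ^ (finrank ℝ E - 1) * |F.det| := by
    intro z
    by_cases hz : z ∈ T
    swap
    · exact ⟨0, fun h => absurd h hz⟩
    obtain ⟨ht, hzW, hzv, hzf⟩ := hTsub z hz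
    obtain ⟨A, g, hA, hAg, hN⟩ := hψ _ hzW hzf
    obtain ⟨F, hF, hFf⟩ := hasFDerivAt_cone hA hzv.1
    refine ⟨F, fun _ => ⟨hF, ?_⟩⟩
    set v := ψ (z - inner ℝ n z • n) - y
    have hv : 0 < ‖v‖ := norm_pos_iff.2 (sub_ne_zero.2 hzv.1)
    have ht0 : (0 : ℝ) < inner ℝ n z := by linarith [ht.1]
    have hdet := le_abs_det_cone (A := A.toLinearMap) (F := F.toLinearMap) hn (div_pos ht0 hv)
      hAg hFf
    rw [hN]
    have hcast : LinearMap.det F.toLinearMap = F.det := rfl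
    set I := |inner ℝ v (‖g‖⁻¹ • g)|
    have hI' : |inner ℝ (‖g‖⁻¹ • g) (‖v‖⁻¹ • v)| = ‖v‖⁻¹ * I := by
      rw [real_inner_smul_right, abs_mul, abs_inv, abs_norm, real_inner_comm]
    rw [hcast, hI'] at hdet
    obtain ⟨m, hm⟩ : ∃ m, finrank ℝ E = m + 1 := ⟨finrank ℝ E - 1, by omega⟩
    rw [hm, Nat.add_sub_cancel] at hdet ⊢
    -- The Jacobian carries the power `t ^ (d - 1)` of the radius; `t > 1/2` bounds it below at the
    -- price of `2 ^ (d - 1)`.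
    have h2 : (1 : ℝ) ≤ 2 * inner ℝ n z := by linarith [ht.1]
    calc I / ‖v‖ ^ (m + 1) ≤ (2 * inner ℝ n z) ^ m * (I / ‖v‖ ^ (m + 1)) :=
          le_mul_of_one_le_left (by positivity) (one_le_pow₀ h2)
      _ = 2 ^ m * ((inner ℝ n z / ‖v‖) ^ m * (‖v‖⁻¹ * I)) := by
          rw [mul_pow, div_pow, pow_succ]
          field_simp
      _ ≤ 2 ^ m * |F.det| := by gcongr
  choose F hF using hΦ
  have hTinj : Set.InjOn Φ T := by
    intro z hz z' hz' he
    obtain ⟨ht, hzW, hzv, hzf⟩ := hTsub z hz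
    obtain ⟨ht', hzW', hzv', hzf'⟩ := hTsub z' hz'
    have he1 : inner ℝ n z • ‖ψ (z - inner ℝ n z • n) - y‖⁻¹ • (ψ (z - inner ℝ n z • n) - y) =
      inner ℝ n z' • ‖ψ (z' - inner ℝ n z' • n) - y‖⁻¹ • (ψ (z' - inner ℝ n z' • n) - y) :=
      add_left_cancel he
    have hu : ‖‖ψ (z - inner ℝ n z • n) - y‖⁻¹ • (ψ (z - inner ℝ n z • n) - y)‖ = 1 :=
      norm_smul_inv_norm (𝕜 := ℝ) (sub_ne_zero.2 hzv.1)
    have hu' : ‖‖ψ (z' - inner ℝ n z' • n) - y‖⁻¹ • (ψ (z' - inner ℝ n z' • n) - y)‖ = 1 :=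
      norm_smul_inv_norm (𝕜 := ℝ) (sub_ne_zero.2 hzv'.1)
    have ht0 : (0 : ℝ) < inner ℝ n z := by linarith [ht.1]
    have ht0' : (0 : ℝ) < inner ℝ n z' := by linarith [ht'.1]
    -- The distance to `y` recovers the radius, visibility then recovers the boundary point, and
    -- injectivity of `ψ` its projection.
    have htt : inner ℝ n z = inner ℝ n z' := by
      have := congrArg norm he1
      rwa [norm_smul (inner ℝ n z), norm_smul (inner ℝ n z'), hu, hu', mul_one, mul_one,
        Real.norm_of_nonneg ht0.le, Real.norm_of_nonneg ht0'.le] at this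
    rw [← htt] at he1 hzv' hzf' hzW'
    have hx := eq_of_mem_visibleFrom hΩ hzv hzv' hzf hzf' (smul_right_injective E ht0.ne' he1)
    exact sub_left_injective (hinj hzW hzW' hx)
  have himage : Φ '' T ⊆ Metric.closedBall y 1 := by
    rintro _ ⟨z, hz, rfl⟩
    obtain ⟨ht, hzW, hzv, hzf⟩ := hTsub z hz
    have hu : ‖‖ψ (z - inner ℝ n z • n) - y‖⁻¹ • (ψ (z - inner ℝ n z • n) - y)‖ = 1 :=
      norm_smul_inv_norm (𝕜 := ℝ) (sub_ne_zero.2 hzv.1)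
    have ht0 : (0 : ℝ) < inner ℝ n z := by linarith [ht.1]
    rw [mem_closedBall_iff_norm]
    simp only [Φ]
    rw [add_sub_cancel_left, norm_smul, hu, mul_one, Real.norm_of_nonneg ht0.le]
    exact ht.2.le
  calc _ ≤ ∫⁻ z in T, ENNReal.ofReal (2 ^ (finrank ℝ E - 1)) * ENNReal.ofReal |(F z).det| ∂μ := by
        refine setLIntegral_mono' hT fun z hz => ?_
        rw [← ENNReal.ofReal_mul (by positivity)]
        exact ENNReal.ofReal_le_ofReal (hF z hz).2
    _ = ENNReal.ofReal (2 ^ (finrank ℝ E - 1)) * μ (Φ '' T) := by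
        rw [lintegral_const_mul' _ _ ENNReal.ofReal_ne_top,
          lintegral_abs_det_fderiv_eq_addHaar_image μ hT
            (fun z hz => (hF z hz).1.hasFDerivWithinAt) hTinj]
    _ ≤ ENNReal.ofReal (2 ^ (finrank ℝ E - 1)) * μ (Metric.closedBall 0 1) := by
        exact mul_le_mul' le_rfl
          ((measure_mono himage).trans (Measure.addHaar_closedBall_center μ y 1).le)

/-! ### Comparison of surface measure with volume -/

/-- A Lipschitz map scales the Euclidean Hausdorff measure by at most a power of its constant. -/
theorem euclideanHausdorffMeasure_image_le {X Y : Type*} [EMetricSpace X] [MeasurableSpace X]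
    [BorelSpace X] [EMetricSpace Y] [MeasurableSpace Y] [BorelSpace Y] {f : X → Y} {K : NNReal}
    {s : Set X} (hf : LipschitzOnWith K f s) (m : ℕ) :
    Measure.euclideanHausdorffMeasure m (f '' s) ≤
      (K : ℝ≥0∞) ^ m * Measure.euclideanHausdorffMeasure m s := by
  simp only [Measure.euclideanHausdorffMeasure_def, Measure.smul_apply, ENNReal.smul_def,
    smul_eq_mul]
  rw [mul_left_comm]
  gcongr
  simpa using hf.hausdorffMeasure_image_le (d := m) (by positivity)

open Classical in
/-- The surface measure on a Lipschitz chart over a hyperplane is dominated by the image of the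
volume under the chart, extended constantly in the transversal direction. -/
theorem restrict_le_map_chart {E : Type*} [NormedAddCommGroup E] [InnerProductSpace ℝ E]
    [FiniteDimensional ℝ E] [MeasurableSpace E] [BorelSpace E] {n : E} (hn : ‖n‖ = 1)
    {ψ : E → E} {W S : Set E} {K : NNReal} (hW : IsOpen W) (hK : LipschitzOnWith K ψ W)
    (hS : MeasurableSet S)
    (hSW : ∀ x ∈ S, x - inner ℝ n x • n ∈ W ∧ ψ (x - inner ℝ n x • n) = x) :
    (Measure.euclideanHausdorffMeasure (finrank ℝ E - 1)).restrict S ≤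
      (2 * (K : ℝ≥0∞) ^ (finrank ℝ E - 1)) •
        ((Measure.euclideanHausdorffMeasure (finrank ℝ E)).restrict
          {z : E | inner ℝ n z ∈ Set.Ioo (1 / 2 : ℝ) 1 ∧ z - inner ℝ n z • n ∈ W}).map
          (fun z => if z - inner ℝ n z • n ∈ W then ψ (z - inner ℝ n z • n) else 0) := by
  have hnn : inner ℝ n n = 1 := by rw [real_inner_self_eq_norm_sq, hn]; norm_num
  have hP : ∀ z : E, inner ℝ n (z - inner ℝ n z • n) = 0 := fun z => by
    rw [inner_sub_right, real_inner_smul_right, hnn]; ring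
  have hPc : Continuous fun z : E => z - inner ℝ n z • n := by fun_prop
  -- Continuity of `ψ` is known only on `W`; the default value 0 elsewhere makes `q` measurable on
  -- the whole space.
  set q : E → E := fun z => if z - inner ℝ n z • n ∈ W then ψ (z - inner ℝ n z • n) else 0
  set Z : Set E := {z : E | inner ℝ n z ∈ Set.Ioo (1 / 2 : ℝ) 1 ∧ z - inner ℝ n z • n ∈ W}
  have hZo : IsOpen Z := by
    have hi : Continuous fun z : E => (inner ℝ n z : ℝ) := by fun_prop
    exact (isOpen_Ioo.preimage hi).inter (hW.preimage hPc)
  have hq : Measurable q := by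
    refine ContinuousOn.measurable_piecewise (s := (fun z : E => z - inner ℝ n z • n) ⁻¹' W)
      (f := fun z => ψ (z - inner ℝ n z • n)) (g := fun _ => 0) ?_ continuousOn_const
      (hW.preimage hPc).measurableSet
    exact hK.continuousOn.comp hPc.continuousOn fun z hz => hz
  refine Measure.le_iff.2 fun B hB => ?_
  rw [Measure.restrict_apply hB, Measure.smul_apply, Measure.map_apply hq hB,
    Measure.restrict_apply (hq hB), smul_eq_mul]
  -- `D` is the part of the hyperplane whose chart image is `B ∩ S`; the cylinder over it is the
  -- preimage of `B ∩ S` under `q` in `Z`.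
  let D : Set E := {p | inner ℝ n p = 0 ∧ p ∈ W ∧ ψ p ∈ B ∩ S}
  have hcyl : {z : E | inner ℝ n z ∈ Set.Ioo (1 / 2 : ℝ) 1 ∧ z - inner ℝ n z • n ∈ D} =
      q ⁻¹' (B ∩ S) ∩ Z := by
    ext z
    have hqz : z - inner ℝ n z • n ∈ W → q z = ψ (z - inner ℝ n z • n) := fun h => if_pos h
    constructor
    · rintro ⟨h1, -, h2, h3⟩
      rw [← hqz h2] at h3
      exact ⟨h3, h1, h2⟩
    · rintro ⟨h1, h2, h3⟩
      rw [Set.mem_preimage, hqz h3] at h1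
      exact ⟨h2, hP z, h3, h1⟩
  have hm : MeasurableSet {z : E | inner ℝ n z ∈ Set.Ioo (1 / 2 : ℝ) 1 ∧
      z - inner ℝ n z • n ∈ D} := by
    rw [hcyl]
    exact (hq (hB.inter hS)).inter hZo.measurableSet
  have hsub : B ∩ S ⊆ ψ '' D := fun x hx =>
    ⟨x - inner ℝ n x • n, ⟨hP x, (hSW x hx.2).1, by rwa [(hSW x hx.2).2]⟩, (hSW x hx.2).2⟩
  calc _ ≤ Measure.euclideanHausdorffMeasure (finrank ℝ E - 1) (ψ '' D) := measure_mono hsub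
    _ ≤ (K : ℝ≥0∞) ^ (finrank ℝ E - 1) * Measure.euclideanHausdorffMeasure (finrank ℝ E - 1) D :=
        euclideanHausdorffMeasure_image_le (hK.mono fun p hp => hp.2.1) _
    _ ≤ (K : ℝ≥0∞) ^ (finrank ℝ E - 1) *
        (2 * Measure.euclideanHausdorffMeasure (finrank ℝ E) (q ⁻¹' (B ∩ S) ∩ Z)) := by
        gcongr
        rw [← hcyl]
        exact euclideanHausdorffMeasure_le_cylinder hn (fun p hp => hp.1) hm
    _ ≤ _ := by
        rw [mul_left_comm, mul_assoc]
        gcongr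
        exact Set.inter_subset_left

/-! ### Uniform bound for the solid angle -/

open Classical in
/-- The weighted solid angle of the visible boundary near a given boundary point is bounded
uniformly in the vertex. -/
theorem exists_lintegral_visibleFrom_le_nhds {d : ℕ} {Ω : Set (EuclideanSpace ℝ (Fin d))}
    (hΩ : IsOpen Ω) (hC : HasC1Boundary Ω) {a : EuclideanSpace ℝ (Fin d)} (ha : a ∈ frontier Ω) :
    ∃ V ∈ 𝓝 a, ∃ C : ℝ≥0∞, C ≠ ⊤ ∧ ∀ y, ∫⁻ x in V ∩ frontier Ω,
      (visibleFrom Ω y).indicator (fun x => ENNReal.ofReal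
        (|inner ℝ (x - y) (outwardNormal Ω x)| / ‖x - y‖ ^ d)) x
        ∂(Measure.euclideanHausdorffMeasure (d - 1)) ≤ C := by
  obtain ⟨n, ψ, W, V, K, hn, hW, hV, haV, hK, hinj, hψ, hVψ⟩ := exists_boundary_chart hΩ hC ha
  have hfr : MeasurableSet (frontier Ω) := isClosed_frontier.measurableSet
  have hmap := restrict_le_map_chart (S := V ∩ frontier Ω) hn hW hK
    (hV.measurableSet.inter hfr) fun x hx => hVψ x hx.1 hx.2
  have hdim : finrank ℝ (EuclideanSpace ℝ (Fin d)) = d := finrank_euclideanSpace_fin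
  have hcone := fun y T => lintegral_cone_le (N := outwardNormal Ω) (y := y) (T := T)
    hn hinj hΩ hψ
  rw [hdim] at hmap hcone
  set μ : Measure (EuclideanSpace ℝ (Fin d)) := Measure.euclideanHausdorffMeasure d
  have hμc : IsFiniteMeasureOnCompacts μ := by
    have : (Measure.euclideanHausdorffMeasure (finrank ℝ (EuclideanSpace ℝ (Fin d))) :
      Measure (EuclideanSpace ℝ (Fin d))).IsAddHaarMeasure := inferInstance
    rw [hdim] at this
    infer_instance
  set q : EuclideanSpace ℝ (Fin d) → EuclideanSpace ℝ (Fin d) :=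
    fun z => if z - inner ℝ n z • n ∈ W then ψ (z - inner ℝ n z • n) else 0
  have hqz : ∀ z, z - inner ℝ n z • n ∈ W → q z = ψ (z - inner ℝ n z • n) := fun z h => if_pos h
  set Z : Set (EuclideanSpace ℝ (Fin d)) :=
    {z | inner ℝ n z ∈ Set.Ioo (1 / 2 : ℝ) 1 ∧ z - inner ℝ n z • n ∈ W}
  have hPc : Continuous fun z : EuclideanSpace ℝ (Fin d) => z - inner ℝ n z • n := by fun_prop
  have hZ : MeasurableSet Z := by
    have hi : Continuous fun z : EuclideanSpace ℝ (Fin d) => (inner ℝ n z : ℝ) := by fun_prop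
    exact ((isOpen_Ioo.preimage hi).inter (hW.preimage hPc)).measurableSet
  have hq : Measurable q :=
    ContinuousOn.measurable_piecewise (s := (fun z => z - inner ℝ n z • n) ⁻¹' W)
      (hK.continuousOn.comp hPc.continuousOn fun z hz => hz) continuousOn_const
      (hW.preimage hPc).measurableSet
  refine ⟨V, hV.mem_nhds haV, (2 * (K : ℝ≥0∞) ^ (d - 1)) *
    (ENNReal.ofReal (2 ^ (d - 1)) * μ (Metric.closedBall 0 1)), ?_, fun y => ?_⟩
  · exact ENNReal.mul_ne_top (ENNReal.mul_ne_top (by simp) (by simp))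
      (ENNReal.mul_ne_top ENNReal.ofReal_ne_top (isCompact_closedBall _ _).measure_lt_top.ne)
  set G : EuclideanSpace ℝ (Fin d) → ℝ≥0∞ := fun x => ENNReal.ofReal
        (|inner ℝ (x - y) (outwardNormal Ω x)| / ‖x - y‖ ^ d)
  have hM : MeasurableSet (visibleFrom Ω y ∩ frontier Ω) :=
    (measurableSet_visibleFrom hΩ y).inter hfr
  have hT : MeasurableSet (q ⁻¹' (visibleFrom Ω y ∩ frontier Ω) ∩ Z) := (hq hM).inter hZ
  calc ∫⁻ x in V ∩ frontier Ω, (visibleFrom Ω y).indicator G x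
        ∂(Measure.euclideanHausdorffMeasure (d - 1))
      = ∫⁻ x in V ∩ frontier Ω, (visibleFrom Ω y ∩ frontier Ω).indicator G x
        ∂(Measure.euclideanHausdorffMeasure (d - 1)) := by
        refine setLIntegral_congr_fun (hV.measurableSet.inter hfr) fun x hx => ?_
        simp only [Set.indicator, Set.mem_inter_iff, hx.2, and_true]
    _ ≤ ∫⁻ x, (visibleFrom Ω y ∩ frontier Ω).indicator G x
        ∂((2 * (K : ℝ≥0∞) ^ (d - 1)) • (μ.restrict Z).map q) := lintegral_mono' hmap le_rfl
    _ ≤ (2 * (K : ℝ≥0∞) ^ (d - 1)) *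
        ∫⁻ z in Z, (visibleFrom Ω y ∩ frontier Ω).indicator G (q z) ∂μ := by
        rw [lintegral_smul_measure, smul_eq_mul]
        -- This direction of the change of variables holds without measurability of `G`, which
        -- involves the normal.
        exact mul_le_mul' le_rfl (lintegral_map_le _ _)
    _ = (2 * (K : ℝ≥0∞) ^ (d - 1)) *
        ∫⁻ z in q ⁻¹' (visibleFrom Ω y ∩ frontier Ω) ∩ Z, G (q z) ∂μ := by
        rw [← Measure.restrict_restrict (hq hM), ← lintegral_indicator (hq hM)]
        rfl
    _ = (2 * (K : ℝ≥0∞) ^ (d - 1)) *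
        ∫⁻ z in q ⁻¹' (visibleFrom Ω y ∩ frontier Ω) ∩ Z, G (ψ (z - inner ℝ n z • n)) ∂μ := by
        congr 1
        refine setLIntegral_congr_fun hT fun z hz => ?_
        rw [← hqz z hz.2.2]
    _ ≤ _ := by
        refine mul_le_mul' le_rfl (hcone y _ hT fun z hz => ?_)
        have hz1 := hz.1
        rw [Set.mem_preimage, hqz z hz.2.2] at hz1
        exact ⟨hz.2.1, hz.2.2, hz1.1, hz1.2⟩

/-- The weighted solid angle under which the visible boundary is seen is bounded uniformly in the
vertex. -/
theorem exists_lintegral_visibleFrom_le {d : ℕ} {Ω : Set (EuclideanSpace ℝ (Fin d))}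
    (hΩ : IsOpen Ω) (hb : Bornology.IsBounded Ω) (hC : HasC1Boundary Ω) :
    ∃ C : ℝ≥0∞, C ≠ ⊤ ∧ ∀ y, ∫⁻ x in frontier Ω,
      (visibleFrom Ω y).indicator (fun x => ENNReal.ofReal
        (|inner ℝ (x - y) (outwardNormal Ω x)| / ‖x - y‖ ^ d)) x
        ∂(Measure.euclideanHausdorffMeasure (d - 1)) ≤ C := by
  have hK : IsCompact (frontier Ω) :=
    hb.isCompact_closure.of_isClosed_subset isClosed_frontier frontier_subset_closure
  suffices h : ∃ C : ℝ≥0∞, C ≠ ⊤ ∧ ∀ y, ∫⁻ x in frontier Ω ∩ frontier Ω,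
      (visibleFrom Ω y).indicator (fun x => ENNReal.ofReal
        (|inner ℝ (x - y) (outwardNormal Ω x)| / ‖x - y‖ ^ d)) x
        ∂(Measure.euclideanHausdorffMeasure (d - 1)) ≤ C by
    simpa only [Set.inter_self] using h
  -- The property passes to subsets and finite unions, so by compactness the local bounds suffice.
  refine hK.induction_on (p := fun s => ∃ C : ℝ≥0∞, C ≠ ⊤ ∧ ∀ y, ∫⁻ x in s ∩ frontier Ω,
      (visibleFrom Ω y).indicator (fun x => ENNReal.ofReal
        (|inner ℝ (x - y) (outwardNormal Ω x)| / ‖x - y‖ ^ d)) x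
        ∂(Measure.euclideanHausdorffMeasure (d - 1)) ≤ C) ?_ ?_ ?_ ?_
  · exact ⟨0, ENNReal.zero_ne_top, fun y => by simp⟩
  · rintro s t hst ⟨C, hC, h⟩
    exact ⟨C, hC, fun y =>
      (lintegral_mono_set (Set.inter_subset_inter_left _ hst)).trans (h y)⟩
  · rintro s t ⟨C, hC, h⟩ ⟨C', hC', h'⟩
    refine ⟨C + C', ENNReal.add_ne_top.2 ⟨hC, hC'⟩, fun y => ?_⟩
    rw [Set.union_inter_distrib_right]
    exact (lintegral_union_le _ _ _).trans (add_le_add (h y) (h' y))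
  · intro a ha
    obtain ⟨V, hV, h⟩ := exists_lintegral_visibleFrom_le_nhds hΩ hC ha
    exact ⟨V, mem_nhdsWithin_of_mem_nhds hV, h⟩

/-! ### Smallness of the kernel and the limit -/

/-- Short chords of the boundary are uniformly almost orthogonal to the normal. -/
theorem exists_forall_abs_inner_outwardNormal_le {d : ℕ} {Ω : Set (EuclideanSpace ℝ (Fin d))}
    (hΩ : IsOpen Ω) (hb : Bornology.IsBounded Ω) (hC : HasC1Boundary Ω) {ε : ℝ} (hε : 0 < ε) :
    ∃ δ > 0, ∀ x ∈ frontier Ω, ∀ y ∈ frontier Ω, dist x y < δ →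
      |inner ℝ (x - y) (outwardNormal Ω y)| ≤ ε * ‖x - y‖ := by
  have hK : IsCompact (frontier Ω) :=
    hb.isCompact_closure.of_isClosed_subset isClosed_frontier frontier_subset_closure
  have h1 : ∀ a ∈ frontier Ω, ∃ U ∈ 𝓝 a, ∀ x ∈ U, ∀ y ∈ U, x ∈ frontier Ω → y ∈ frontier Ω →
      |inner ℝ (x - y) (outwardNormal Ω y)| ≤ ε * ‖x - y‖ := by
    intro a ha
    have h2 := eventually_abs_inner_outwardNormal_le hΩ hC ha hε
    rw [nhds_prod_eq, eventually_prod_self_iff'] at h2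
    obtain ⟨U, hU, h⟩ := h2
    exact ⟨U, hU, fun x hx y hy => h x hx y hy⟩
  choose! U hU hUp using h1
  -- A Lebesgue number places both ends of a short chord in one neighbourhood `U a`.
  obtain ⟨δ, hδ, h⟩ := Metric.uniformity_basis_dist.lebesgue_number_lemma_nhds' hK hU
  refine ⟨δ, hδ, fun x hx y hy hxy => ?_⟩
  obtain ⟨a, ha⟩ := h x hx
  exact hUp a a.2 x (ha (by simpa [UniformSpace.ball] using hδ)) y
    (ha (by simpa [UniformSpace.ball] using hxy)) hx hy

/-- A point from which `y` is reached is visible from `y`. -/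
theorem mem_visibleFrom_of_exitTime {d : ℕ} {Ω : Set (EuclideanSpace ℝ (Fin d))}
    {x y : EuclideanSpace ℝ (Fin d)} (hne : x ≠ y)
    (h : y = x - exitTime Ω x (direction x y) • direction x y) : x ∈ visibleFrom Ω y := by
  refine ⟨hne, fun t ht => ?_⟩
  have h0 : 0 < ‖x - y‖ := norm_pos_iff.2 (sub_ne_zero.2 hne)
  have hu : ‖direction x y‖ = 1 := norm_smul_inv_norm (𝕜 := ℝ) (sub_ne_zero.2 hne)
  have hxy : x - y = ‖x - y‖ • direction x y := by
    rw [direction, smul_smul, mul_inv_cancel₀ h0.ne', one_smul]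
  have hτ : exitTime Ω x (direction x y) = ‖x - y‖ := by
    have h1 : exitTime Ω x (direction x y) • direction x y = ‖x - y‖ • direction x y := by
      rw [← hxy]
      nth_rw 3 [h]
      abel
    exact smul_left_injective ℝ (norm_ne_zero_iff.1 (by rw [hu]; norm_num)) h1
  by_contra hn
  -- The point with parameter `t` from `y` has distance `(1 - t) * ‖x - y‖` from `x`; were it
  -- outside `Ω`, the exit time would be less than `‖x - y‖`.
  have hmem : (1 - t) * ‖x - y‖ ∈ {s : ℝ | 0 < s ∧ x - s • direction x y ∉ Ω} := by
    refine ⟨mul_pos (by linarith [ht.2]) h0, ?_⟩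
    rw [mul_smul, ← hxy]
    convert hn using 2
    module
  have hle : exitTime Ω x (direction x y) ≤ (1 - t) * ‖x - y‖ :=
    csInf_le ⟨0, fun s hs => hs.1.le⟩ hmem
  rw [hτ] at hle
  nlinarith [ht.1]

/-- The kernel is bounded by the density of the solid angle, with a factor that measures how far
the chord is from being orthogonal to the normal at `y`. -/
theorem ofReal_kernelJ_le {d : ℕ} {Ω : Set (EuclideanSpace ℝ (Fin d))}
    {x y : EuclideanSpace ℝ (Fin d)} {ε : ℝ} (hε : 0 ≤ ε)
    (h : |inner ℝ (x - y) (outwardNormal Ω y)| ≤ ε * ‖x - y‖) :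
    ENNReal.ofReal (kernelJ Ω x y) ≤ ENNReal.ofReal ε * (visibleFrom Ω y).indicator
      (fun x => ENNReal.ofReal (|inner ℝ (x - y) (outwardNormal Ω x)| / ‖x - y‖ ^ d)) x := by
  by_cases hJ : 0 < inner ℝ (x - y) (outwardNormal Ω x) ∧
      inner ℝ (x - y) (outwardNormal Ω y) < 0 ∧
      y = x - exitTime Ω x (direction x y) • direction x y
  · have hne : x ≠ y := by
      rintro rfl
      simpa using hJ.1
    have h0 : 0 < ‖x - y‖ := norm_pos_iff.2 (sub_ne_zero.2 hne)
    rw [kernelJ, if_pos hJ, Set.indicator_of_mem (mem_visibleFrom_of_exitTime hne hJ.2.2),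
      ← ENNReal.ofReal_mul hε]
    refine ENNReal.ofReal_le_ofReal ?_
    calc _ ≤ |inner ℝ (x - y) (outwardNormal Ω x)| / ‖x - y‖ ^ (d + 1) * (ε * ‖x - y‖) := by
          gcongr
      _ = _ := by
          rw [pow_succ]
          field_simp
  · rw [kernelJ, if_neg hJ, ENNReal.ofReal_zero]
    exact zero_le

end DiffuseBoundary

end

theorem lemmaB4 (d : ℕ) (hd : 2 ≤ d) (Ω : Set (EuclideanSpace ℝ (Fin d)))
    (hΩ_open : IsOpen Ω) (hΩ_bdd : Bornology.IsBounded Ω)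
    (hΩ_C1 : DiffuseBoundary.HasC1Boundary Ω) :
    Tendsto
      (fun δ : ℝ => ⨆ y ∈ frontier Ω,
        ∫⁻ x in Metric.closedBall y δ, ENNReal.ofReal (DiffuseBoundary.kernelJ Ω x y)
          ∂(DiffuseBoundary.surfaceMeasure Ω))
      (𝓝[>] 0) (𝓝 0) := by
  obtain ⟨C, hC, hCle⟩ :=
    DiffuseBoundary.exists_lintegral_visibleFrom_le hΩ_open hΩ_bdd hΩ_C1
  rw [ENNReal.tendsto_nhds_zero]
  intro ε hε
  obtain ⟨η, hη, hηC⟩ : ∃ η : ℝ, 0 < η ∧ ENNReal.ofReal η * C ≤ ε := by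
    obtain ⟨r, hr, hrC⟩ := ENNReal.exists_nnreal_pos_mul_lt hC hε.ne'
    exact ⟨r, hr, by simpa using hrC.le⟩
  obtain ⟨δ, hδ, hδle⟩ :=
    DiffuseBoundary.exists_forall_abs_inner_outwardNormal_le hΩ_open hΩ_bdd hΩ_C1 hη
  filter_upwards [nhdsWithin_le_nhds (Iio_mem_nhds hδ)] with s hs
  refine iSup₂_le fun y hy => ?_
  have hfr : MeasurableSet (frontier Ω) := isClosed_frontier.measurableSet
  rw [DiffuseBoundary.surfaceMeasure, Measure.restrict_restrict measurableSet_closedBall]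
  refine le_trans ?_ hηC
  refine le_trans ?_ (mul_le_mul' le_rfl (hCle y))
  rw [← lintegral_const_mul' _ _ ENNReal.ofReal_ne_top]
  -- The ball serves only to make chords short; the solid-angle density is then integrated over the
  -- whole boundary.
  refine le_trans ?_ (lintegral_mono_set (s := Metric.closedBall y s ∩ frontier Ω)
    Set.inter_subset_right)
  refine setLIntegral_mono' (measurableSet_closedBall.inter hfr) fun x hx => ?_
  exact DiffuseBoundary.ofReal_kernelJ_le hη.le
    (hδle x hx.2 y hy (lt_of_le_of_lt hx.1 hs))
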